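/- Let $n\in\mathbb N$, let $J=\begin{pmatrix}0&\mathbb 1_n\\-\mathbb 1_n&0\end{pmatrix}\in\mathbb R^{2n\times 2n}$, and let $Sp(2n)=\{S\in\mathbb R^{2n\times 2n} : S^TJS=J\}$. Matrix inequalities are understood in the positive semidefinite order on Hermitian matrices. A covariance matrix is a matrix $\Gamma\in\mathbb R^{2n\times 2n}$ with $\Gamma\ge iJ$, i.e. such that $\Gamma-iJ$ is Hermitian and positive semidefinite; in particular $\Gamma$ is symmetric. For $S\in\mathbb R^{2n\times 2n}$ with singular values $s_1(S)\ge s_2(S)\ge\dots\ge s_{2n}(S)$ put $F(S)=\sum_{i=1}^n\log s_i(S)$, and for a covariance matrix $\Gamma$ define $$G(\Gamma)=\inf\{F(S) : S\in Sp(2n),\ S^TS\le\Gamma\}.$$ Then, for every covariance matrix $\Gamma$, the infimum is taken over a nonempty set that is bounded below, so that $G$ is a well-defined real-valued function on the set of covariance matrices, and: 1. $G$ is lower semicontinuous on the set of covariance matrices $\{\Gamma\in\mathbb R^{2n\times 2n} : \Gamma\ge iJ\}$. 2. $G$ is continuous on the interior of this set, where the interior is taken in the space of real symmetric $2n\times 2n$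 matrices. 3. For every covariance matrix $\Gamma$, $G(\Gamma+\varepsilon\mathbb 1)\to G(\Gamma)$ as $\varepsilon\downarrow 0$. -/

import Mathlib

open scoped Matrix Topology ComplexOrder

noncomputable section

/-- Real `2n × 2n` matrices, in the block ordering `(Q₁, …, Qₙ, P₁, …, Pₙ)` of the canonical
variables. -/
abbrev PhaseMatrix (n : ℕ) : Type := Matrix (Fin n ⊕ Fin n) (Fin n ⊕ Fin n) ℝ

/-- The standard symplectic form `J = [[0, 1], [-1, 0]]`. (Mathlib's `Matrix.J` is its negative.) -/
def sympForm (n : ℕ) : PhaseMatrix n := Matrix.fromBlocks 0 1 (-1) 0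

/-- Mathlib's symplectic group is the group `Sp(2n)` of all real `S` with `Sᵀ J S = J`. -/
theorem mem_symplecticGroup_iff_sympForm (n : ℕ) (S : PhaseMatrix n) :
    S ∈ Matrix.symplecticGroup (Fin n) ℝ ↔ Sᵀ * sympForm n * S = sympForm n := by
  have h : sympForm n = -Matrix.J (Fin n) ℝ := by
    simp [sympForm, Matrix.J, Matrix.fromBlocks_neg]
  rw [h, ← SymplecticGroup.transpose_mem_iff, SymplecticGroup.mem_iff]
  simp

/-- The set of covariance matrices of `n`-mode states: all real `Γ` with `Γ ≥ iJ`, that is, such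
that the complex matrix `Γ - iJ` is Hermitian and positive semidefinite. Such `Γ` are symmetric. -/
def covarianceMatrices (n : ℕ) : Set (PhaseMatrix n) :=
  {Γ | (Γ.map (fun x : ℝ => (x : ℂ)) -
    Complex.I • (sympForm n).map (fun x : ℝ => (x : ℂ))).PosSemidef}

/-- `F(A) = ∑_{i=1}^n log s_i(A)`, with `s_1(A) ≥ s_2(A) ≥ … ≥ s_{2n}(A)` the singular values of
`A` (Mathlib's `singularValues` is the decreasing sequence, indexed from `0`). -/
def squeezingF {n : ℕ} (A : PhaseMatrix n) : ℝ :=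
  ∑ i ∈ Finset.range n, Real.log ((Matrix.toEuclideanLin A).singularValues i)

/-- The costs `F(S)` of all symplectic `S` with `SᵀS ≤ Γ`. -/
def squeezingCosts {n : ℕ} (Γ : PhaseMatrix n) : Set ℝ :=
  {c | ∃ S : PhaseMatrix n, S ∈ Matrix.symplecticGroup (Fin n) ℝ ∧
    (Γ - Sᵀ * S).PosSemidef ∧ c = squeezingF S}

/-- The squeezing measure `G(Γ) = inf {F(S) | SᵀS ≤ Γ, S ∈ Sp(2n)}`. -/
def squeezingG {n : ℕ} (Γ : PhaseMatrix n) : ℝ := sInf (squeezingCosts Γ)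

/-- The space of real symmetric `2n × 2n` matrices, with the subspace topology. -/
abbrev SymmPhaseMatrix (n : ℕ) : Type := {Γ : PhaseMatrix n // Γ.IsSymm}

/-- The interior of the set of covariance matrices, taken in the space of real symmetric matrices
(in the space of all real matrices the interior is empty for `n ≥ 1`). -/
def covarianceInterior (n : ℕ) : Set (SymmPhaseMatrix n) :=
  interior {Γ : SymmPhaseMatrix n | (Γ : PhaseMatrix n) ∈ covarianceMatrices n}

end

/-!
For `Γ ≥ iJ` the geometric mean `M` of `Γ` and `Jᵀ Γ⁻¹ J` satisfies `M J⁻¹ M = -J` and `M ≤ Γ`, so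
`√M` is a symplectic matrix with `(√M)ᵀ √M ≤ Γ`: the infimum is over a nonempty set.

Since `Aᵀ A ≤ c² Bᵀ B` implies `sᵢ(A) ≤ c sᵢ(B)`, the function `F` is lower semicontinuous at
invertible matrices. The feasible sets are closed, and bounded locally uniformly in `Γ`, so the
infimum is attained and `G` is lower semicontinuous. As `G` is antitone, this already gives
`G(Γ + ε1) → G(Γ)`.

If `Γ - δ1` is still a covariance matrix and `S` is optimal for `Γ`, then
`(1 - t) SᵀS + t (Γ - δ1)` is a covariance matrix below `Γ - tδ1`. Hence every symplectic `T`
feasible for it is feasible for all symmetric `Γ'` near `Γ`, and `F(T)` exceeds `F(S)` by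
arbitrarily little for small `t`, which is upper semicontinuity.
-/

section SingularValues

open Module

variable {𝕜 E F G : Type*} [RCLike 𝕜]
  [NormedAddCommGroup E] [InnerProductSpace 𝕜 E] [FiniteDimensional 𝕜 E]
  [NormedAddCommGroup F] [InnerProductSpace 𝕜 F] [FiniteDimensional 𝕜 F]
  [NormedAddCommGroup G] [InnerProductSpace 𝕜 G] [FiniteDimensional 𝕜 G]

/-- The right singular vectors of `T`: an orthonormal eigenbasis of `T* T`, ordered so that the
`j`-th vector belongs to the `j`-th singular value of `T`. -/
noncomputable def rightSingularBasis (T : E →ₗ[𝕜] F) :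
    OrthonormalBasis (Fin (finrank 𝕜 E)) 𝕜 E :=
  T.isSymmetric_adjoint_comp_self.eigenvectorBasis rfl

theorem norm_sq_apply_eq_sum_singularValues (T : E →ₗ[𝕜] F) (v : E) :
    ‖T v‖ ^ 2 =
      ∑ j : Fin (finrank 𝕜 E), T.singularValues j ^ 2 * ‖(rightSingularBasis T).repr v j‖ ^ 2 := by
  set b := rightSingularBasis T
  have hb (j) : b.repr ((LinearMap.adjoint T ∘ₗ T) v) j =
      ((T.singularValues j ^ 2 : ℝ) : 𝕜) * b.repr v j := by
    rw [T.sq_singularValues_fin rfl j]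
    exact T.isSymmetric_adjoint_comp_self.eigenvectorBasis_apply_self_apply rfl v j
  have hinner : inner 𝕜 (b.repr v) (b.repr ((LinearMap.adjoint T ∘ₗ T) v)) = (‖T v‖ : 𝕜) ^ 2 := by
    rw [b.repr.inner_map_map, LinearMap.comp_apply, LinearMap.adjoint_inner_right,
      inner_self_eq_norm_sq_to_K]
  have hsum : ((‖T v‖ ^ 2 : ℝ) : 𝕜) =
      ((∑ j : Fin (finrank 𝕜 E), T.singularValues j ^ 2 * ‖b.repr v j‖ ^ 2 : ℝ) : 𝕜) := by
    push_cast
    rw [← hinner, PiLp.inner_apply]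
    refine Finset.sum_congr rfl fun j _ => ?_
    rw [hb, RCLike.inner_apply, mul_assoc, RCLike.mul_conj]
    push_cast
    rfl
  exact RCLike.ofReal_injective hsum

theorem norm_apply_le_singularValues_mul_norm (T : E →ₗ[𝕜] F) {i : ℕ} {v : E}
    (hv : ∀ j : Fin (finrank 𝕜 E), j < i → (rightSingularBasis T).repr v j = 0) :
    ‖T v‖ ≤ T.singularValues i * ‖v‖ := by
  have hi := T.singularValues_nonneg i
  refine (sq_le_sq₀ (by positivity) (by positivity)).1 ?_
  rw [mul_pow, norm_sq_apply_eq_sum_singularValues, ← (rightSingularBasis T).repr.norm_map v,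
    EuclideanSpace.norm_sq_eq, Finset.mul_sum]
  refine Finset.sum_le_sum fun j _ => ?_
  rcases lt_or_ge (j : ℕ) i with hj | hj
  · simp [hv j hj]
  · gcongr
    exacts [T.singularValues_nonneg j, T.singularValues_antitone hj]

theorem singularValues_mul_norm_le_norm_apply (T : E →ₗ[𝕜] F) {i : ℕ} {v : E}
    (hv : ∀ j : Fin (finrank 𝕜 E), i < j → (rightSingularBasis T).repr v j = 0) :
    T.singularValues i * ‖v‖ ≤ ‖T v‖ := by
  have hi := T.singularValues_nonneg i
  refine (sq_le_sq₀ (by positivity) (by positivity)).1 ?_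
  rw [mul_pow, norm_sq_apply_eq_sum_singularValues, ← (rightSingularBasis T).repr.norm_map v,
    EuclideanSpace.norm_sq_eq, Finset.mul_sum]
  refine Finset.sum_le_sum fun j _ => ?_
  rcases lt_or_ge i (j : ℕ) with hj | hj
  · simp [hv j hj]
  · gcongr
    exact T.singularValues_antitone hj

theorem exists_ne_zero_repr_eq_zero_of_lt_of_gt {K V ι : Type*} [Field K] [AddCommGroup V]
    [Module K V] [Finite ι] [LinearOrder ι] (a b : Basis ι K V) (i : ι) :
    ∃ v ≠ 0, (∀ j < i, a.repr v j = 0) ∧ ∀ j > i, b.repr v j = 0 := by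
  cases nonempty_fintype ι
  have := Module.Finite.of_basis a
  let φ : V →ₗ[K] ({j // j ≠ i} → K) :=
    LinearMap.pi fun j => if (j : ι) < i then a.coord j else b.coord j
  have hrank : finrank K ({j // j ≠ i} → K) < finrank K V := by
    rw [finrank_fintype_fun_eq_card, finrank_eq_card_basis a]
    exact Fintype.card_subtype_lt (x := i) (by simp)
  obtain ⟨v, hv, hv0⟩ := (Submodule.ne_bot_iff _).1 (LinearMap.ker_ne_bot_of_finrank_lt hrank)
  have hφ (j) : φ v j = 0 := congrFun (LinearMap.mem_ker.1 hv) j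
  refine ⟨v, hv0, fun j hj => ?_, fun j hj => ?_⟩
  · simpa [φ, hj] using hφ ⟨j, hj.ne⟩
  · simpa [φ, hj.le.not_gt] using hφ ⟨j, hj.ne'⟩

theorem singularValues_le_mul_singularValues_of_norm_le (A : E →ₗ[𝕜] F) (B : E →ₗ[𝕜] G) {c : ℝ}
    (hc : 0 ≤ c) (h : ∀ v, ‖A v‖ ≤ c * ‖B v‖) (i : ℕ) :
    A.singularValues i ≤ c * B.singularValues i := by
  by_cases! hi : finrank 𝕜 E ≤ i
  · simp [A.singularValues_of_finrank_le hi, B.singularValues_of_finrank_le hi]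
  obtain ⟨v, hv0, hvB, hvA⟩ := exists_ne_zero_repr_eq_zero_of_lt_of_gt
    (rightSingularBasis B).toBasis (rightSingularBasis A).toBasis ⟨i, hi⟩
  refine le_of_mul_le_mul_right ?_ (norm_pos_iff.2 hv0)
  calc A.singularValues i * ‖v‖ ≤ ‖A v‖ := singularValues_mul_norm_le_norm_apply A fun j hj => by
        simpa using hvA j hj
    _ ≤ c * ‖B v‖ := h v
    _ ≤ c * (B.singularValues i * ‖v‖) := by
        gcongr
        exact norm_apply_le_singularValues_mul_norm B fun j hj => by simpa using hvB j hj
    _ = c * B.singularValues i * ‖v‖ := (mul_assoc _ _ _).symm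

theorem singularValues_toEuclideanLin_pos {𝕜 m : Type*} [RCLike 𝕜] [Fintype m] [DecidableEq m]
    {A : Matrix m m 𝕜} (hA : IsUnit A) {i : ℕ} (hi : i < Fintype.card m) :
    0 < (Matrix.toEuclideanLin A).singularValues i := by
  refine (LinearMap.injective_iff_forall_lt_finrank_singularValues_pos _).1 (fun v w hvw => ?_) i
    (by simpa using hi)
  exact WithLp.ofLp_injective 2
    (Matrix.mulVec_injective_of_isUnit hA (congrArg WithLp.ofLp hvw))

end SingularValues

section LoewnerOrder

open scoped MatrixOrder

variable {𝕜 m k : Type*} [RCLike 𝕜]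

theorem isClosed_setOf_posSemidef [Finite m] : IsClosed {A : Matrix m m 𝕜 | A.PosSemidef} := by
  cases nonempty_fintype m
  simp only [Matrix.posSemidef_iff_dotProduct_mulVec, Matrix.IsHermitian, Set.ofPred_and,
    Set.ofPred_forall]
  refine .inter (isClosed_eq (by fun_prop) continuous_id) (isClosed_iInter fun x => ?_)
  exact isClosed_le continuous_const (by fun_prop)

theorem isClosed_setOf_le [Finite m] :
    IsClosed {p : Matrix m m 𝕜 × Matrix m m 𝕜 | p.1 ≤ p.2} :=
  isClosed_setOf_posSemidef.preimage (continuous_snd.sub continuous_fst)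

theorem eventually_posDef_of_isHermitian [Finite m] {M : Matrix m m 𝕜} (hM : M.PosDef) :
    ∀ᶠ N in 𝓝 M, N.IsHermitian → N.PosDef := by
  cases nonempty_fintype m
  have hquad : Continuous fun p : Matrix m m 𝕜 × (m → 𝕜) =>
      RCLike.re (star p.2 ⬝ᵥ p.1 *ᵥ p.2) := by fun_prop
  have hsphere : ∀ᶠ N in 𝓝 M, ∀ x ∈ Metric.sphere (0 : m → 𝕜) 1,
      0 < RCLike.re (star x ⬝ᵥ N *ᵥ x) := by
    refine (isCompact_sphere _ _).eventually_forall_of_forall_eventually fun x hx => ?_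
    have hx0 : x ≠ 0 := ne_zero_of_mem_unit_sphere ⟨x, hx⟩
    exact hquad.continuousAt.eventually
      (lt_mem_nhds (RCLike.pos_iff.1 (hM.dotProduct_mulVec_pos hx0)).1)
  filter_upwards [hsphere] with N hN hherm
  refine .of_dotProduct_mulVec_pos hherm fun x hx => RCLike.pos_iff.2
    ⟨?_, hherm.im_star_dotProduct_mulVec_self x⟩
  have hnorm : 0 < ‖x‖ := norm_pos_iff.2 hx
  have hunit : 0 < RCLike.re (star (‖x‖⁻¹ • x) ⬝ᵥ N *ᵥ (‖x‖⁻¹ • x)) :=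
    hN _ (by simp [norm_smul, hnorm.ne'])
  rw [star_smul, star_trivial, Matrix.mulVec_smul, smul_dotProduct, dotProduct_smul,
    RCLike.smul_re, RCLike.smul_re] at hunit
  exact pos_of_mul_pos_right (pos_of_mul_pos_right hunit (by positivity)) (by positivity)

theorem eventually_le_smul [Finite m] {M : Matrix m m 𝕜} (hM : M.PosDef) {c : ℝ} (hc : 1 < c) :
    ∀ᶠ N in 𝓝 M, N.IsHermitian → N ≤ c • M := by
  have hpd : ((c - 1) • M).PosDef := hM.smul (sub_pos.2 hc)
  have hlim : Filter.Tendsto (fun N => c • M - N) (𝓝 M) (𝓝 ((c - 1) • M)) := by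
    rw [sub_smul, one_smul]
    exact (by fun_prop : Continuous fun N => c • M - N).tendsto M
  filter_upwards [hlim.eventually (eventually_posDef_of_isHermitian hpd)] with N hN hherm
  exact (hN ((hM.isHermitian.smul (.all c)).sub hherm)).posSemidef

theorem eventually_ge_smul [Finite m] {M : Matrix m m 𝕜} (hM : M.PosDef) {c : ℝ} (hc : 1 < c) :
    ∀ᶠ N in 𝓝 M, N.IsHermitian → M ≤ c • N := by
  have hpd : ((c - 1) • M).PosDef := hM.smul (sub_pos.2 hc)
  have hlim : Filter.Tendsto (fun N => c • N - M) (𝓝 M) (𝓝 ((c - 1) • M)) := by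
    rw [sub_smul, one_smul]
    exact (by fun_prop : Continuous fun N => c • N - M).tendsto M
  filter_upwards [hlim.eventually (eventually_posDef_of_isHermitian hpd)] with N hN hherm
  exact (hN ((hherm.smul (.all c)).sub hM.isHermitian)).posSemidef

theorem eventually_sub_le [Finite m] {M P : Matrix m m 𝕜} (hM : M.IsHermitian)
    (hP : P.PosDef) : ∀ᶠ N in 𝓝 M, N.IsHermitian → M - P ≤ N := by
  have hlim : Filter.Tendsto (fun N => N - (M - P)) (𝓝 M) (𝓝 P) := by
    simpa using (by fun_prop : Continuous fun N => N - (M - P)).tendsto M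
  filter_upwards [hlim.eventually (eventually_posDef_of_isHermitian hP)] with N hN hherm
  exact (hN (hherm.sub (hM.sub hP.isHermitian))).posSemidef

theorem abs_apply_le_sqrt_of_transpose_mul_self_le [Fintype k] {S : Matrix k m ℝ}
    {Γ : Matrix m m ℝ} (h : Sᵀ * S ≤ Γ) (i : k) (j : m) : |S i j| ≤ √(Γ j j) := by
  have hdiag : ∑ l, S l j ^ 2 ≤ Γ j j := by
    simpa [Matrix.mul_apply, sq] using (Matrix.le_iff.1 h).diag_nonneg (i := j)
  exact Real.abs_le_sqrt <|
    (Finset.single_le_sum (fun l _ => sq_nonneg (S l j)) (Finset.mem_univ i)).trans hdiag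

theorem le_one_of_isHermitian_of_mul_self_le_one [Fintype m] [DecidableEq m] {P : Matrix m m 𝕜}
    (hP : P.IsHermitian) (h : P * P ≤ 1) : P ≤ 1 := by
  have hsq : ((1 - P) * (1 - P)).PosSemidef := by
    nth_rw 1 [← (Matrix.isHermitian_one.sub hP).eq]
    exact Matrix.posSemidef_conjTranspose_mul_self (1 - P)
  have hsum : (1 - P * P) + (1 - P) * (1 - P) = (2 : ℝ) • (1 - P) := by
    rw [two_smul]
    noncomm_ring
  have htwo : ((2 : ℝ) • (1 - P)).PosSemidef := hsum ▸ (Matrix.le_iff.1 h).add hsq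
  rw [Matrix.le_iff, ← inv_smul_smul₀ (two_ne_zero (α := ℝ)) (1 - P)]
  exact htwo.smul (by norm_num)

theorem norm_toEuclideanLin_le_of_conjTranspose_mul_self_le [Fintype m] [Fintype k] [DecidableEq m]
    {A B : Matrix k m 𝕜} {c : ℝ} (hc : 0 ≤ c) (h : Aᴴ * A ≤ c ^ 2 • (Bᴴ * B))
    (v : EuclideanSpace 𝕜 m) : ‖Matrix.toEuclideanLin A v‖ ≤ c * ‖Matrix.toEuclideanLin B v‖ := by
  have hnorm (C : Matrix k m 𝕜) : ((‖Matrix.toEuclideanLin C v‖ ^ 2 : ℝ) : 𝕜) =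
      star v.ofLp ⬝ᵥ (Cᴴ * C) *ᵥ v.ofLp := by
    rw [← Matrix.mulVec_mulVec, Matrix.dotProduct_mulVec, ← Matrix.star_mulVec,
      RCLike.ofReal_pow, ← inner_self_eq_norm_sq_to_K, EuclideanSpace.inner_eq_star_dotProduct,
      dotProduct_comm]
    rfl
  have hquad := (Matrix.le_iff.1 h).dotProduct_mulVec_nonneg v.ofLp
  rw [Matrix.sub_mulVec, dotProduct_sub, Matrix.smul_mulVec, dotProduct_smul, ← hnorm, ← hnorm,
    RCLike.real_smul_eq_coe_mul, ← RCLike.ofReal_mul, ← RCLike.ofReal_sub, RCLike.ofReal_nonneg,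
    ← mul_pow, sub_nonneg] at hquad
  exact (sq_le_sq₀ (by positivity) (by positivity)).1 hquad

end LoewnerOrder

theorem isCompact_setOf_abs_apply_le {m k : Type*} (b : m → k → ℝ) :
    IsCompact {S : Matrix m k ℝ | ∀ i j, |S i j| ≤ b i j} := by
  have hpi : {S : Matrix m k ℝ | ∀ i j, |S i j| ≤ b i j} =
      Set.univ.pi fun i => Set.univ.pi fun j => Set.Icc (-b i j) (b i j) := by
    ext S
    simp only [abs_le, Set.mem_ofPred_eq]
    exact ⟨fun h i _ j _ => h i j, fun h i j => h i trivial j trivial⟩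
  rw [hpi]
  exact isCompact_univ_pi fun _ => isCompact_univ_pi fun _ => isCompact_Icc

theorem eventually_forall_mem_compact_lt {X Y α : Type*} [TopologicalSpace X] [TopologicalSpace Y]
    [Preorder α] {K : Set Y} (hK : IsCompact K) {R : Set (X × Y)} (hR : IsClosed R) {f : Y → α}
    {x : X} (hf : ∀ y, (x, y) ∈ R → LowerSemicontinuousAt f y) {a : α}
    (ha : ∀ y, (x, y) ∈ R → a < f y) :
    ∀ᶠ x' in 𝓝 x, ∀ y ∈ K, (x', y) ∈ R → a < f y := by
  refine hK.eventually_forall_of_forall_eventually fun y _ => ?_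
  by_cases hy : (x, y) ∈ R
  · filter_upwards [continuous_snd.continuousAt.eventually (hf y hy a (ha y hy))] with p hp _
    exact hp
  · filter_upwards [hR.isOpen_compl.mem_nhds hy] with p hp hpR
    exact absurd hpR hp

theorem exists_one_lt_mul_log_lt (a : ℝ) {δ : ℝ} (hδ : 0 < δ) :
    ∃ c : ℝ, 1 < c ∧ a * Real.log c < δ := by
  have hcont : ContinuousAt (fun c => a * Real.log c) 1 :=
    continuousAt_const.mul (Real.continuousAt_log one_ne_zero)
  have hlt : ∀ᶠ c in 𝓝[>] (1 : ℝ), a * Real.log c < δ :=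
    (hcont.eventually (gt_mem_nhds (by simpa using hδ))).filter_mono nhdsWithin_le_nhds
  have hgt : ∀ᶠ c in 𝓝[>] (1 : ℝ), 1 < c := self_mem_nhdsWithin
  exact (hgt.and hlt).exists

section GeometricMean

open scoped MatrixOrder

variable {𝕜 m l : Type*} [RCLike 𝕜] [Fintype m] [DecidableEq m] [Fintype l] [DecidableEq l]

theorem abs_mul_inv_mul_abs {B : Matrix m m 𝕜} (hB : Bᴴ = -B) (hu : IsUnit B) :
    CFC.abs B * B⁻¹ * CFC.abs B = -B := by
  have hdet := (Matrix.isUnit_iff_isUnit_det B).1 hu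
  have hcomm : CFC.abs B * B = B * CFC.abs B := by
    refine (Commute.refl B).cfcAbs_left ?_
    rw [Matrix.star_eq_conjTranspose, hB]
    exact (Commute.refl B).neg_right
  have hsq : CFC.abs B * CFC.abs B = -(B * B) := by
    rw [CFC.abs_mul_abs, Matrix.star_eq_conjTranspose, hB, neg_mul]
  refine hu.mul_left_cancel ?_
  calc B * (CFC.abs B * B⁻¹ * CFC.abs B)
      = CFC.abs B * (B * B⁻¹) * CFC.abs B := by simp only [← mul_assoc, hcomm]
    _ = B * -B := by rw [Matrix.mul_nonsing_inv _ hdet, mul_one, hsq, mul_neg]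

theorem abs_inv_mul_mul_inv_le_one {R X : Matrix m m 𝕜} (hR : R.IsHermitian) (hu : IsUnit R)
    (h : Xᴴ * (R * R)⁻¹ * X ≤ R * R) : CFC.abs (R⁻¹ * X * R⁻¹) ≤ 1 := by
  have hdet := (Matrix.isUnit_iff_isUnit_det R).1 hu
  refine le_one_of_isHermitian_of_mul_self_le_one
    (Matrix.nonneg_iff_posSemidef.1 (CFC.abs_nonneg _)).isHermitian ?_
  calc CFC.abs (R⁻¹ * X * R⁻¹) * CFC.abs (R⁻¹ * X * R⁻¹)
      = R⁻¹ * (Xᴴ * (R * R)⁻¹ * X) * R⁻¹ := by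
        rw [CFC.abs_mul_abs, Matrix.star_eq_conjTranspose, Matrix.mul_inv_rev]
        simp only [Matrix.conjTranspose_mul, hR.inv.eq, mul_assoc]
    _ ≤ R⁻¹ * (R * R) * R⁻¹ := IsSelfAdjoint.conjugate_le_conjugate h hR.inv.isSelfAdjoint
    _ = (R⁻¹ * R) * (R * R⁻¹) := by simp only [mul_assoc]
    _ = 1 := by rw [Matrix.nonsing_inv_mul _ hdet, Matrix.mul_nonsing_inv _ hdet, one_mul]

theorem exists_posSemidef_le_mul_inv_mul_eq_neg {Γ J : Matrix m m 𝕜} (hΓ : Γ.PosDef)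
    (hJ : Jᴴ = -J) (hu : IsUnit J) (h : Jᴴ * Γ⁻¹ * J ≤ Γ) :
    ∃ M : Matrix m m 𝕜, M.PosSemidef ∧ M ≤ Γ ∧ M * J⁻¹ * M = -J := by
  set R := CFC.sqrt Γ
  have hRR : R * R = Γ := CFC.sqrt_mul_sqrt_self Γ hΓ.posSemidef.nonneg
  have hR : R.IsHermitian := (Matrix.nonneg_iff_posSemidef.1 (CFC.sqrt_nonneg Γ)).isHermitian
  have hRu : IsUnit R := isUnit_of_mul_isUnit_left (hRR ▸ hΓ.isUnit)
  have hdet := (Matrix.isUnit_iff_isUnit_det R).1 hRu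
  have hRi : R * R⁻¹ = 1 := Matrix.mul_nonsing_inv _ hdet
  have hiR : R⁻¹ * R = 1 := Matrix.nonsing_inv_mul _ hdet
  set B := R⁻¹ * J * R⁻¹
  have hB : Bᴴ = -B := by
    simp [B, Matrix.conjTranspose_mul, hR.inv.eq, hJ, mul_assoc]
  have hBu : IsUnit B := ((Matrix.isUnit_nonsing_inv_iff.2 hRu).mul hu).mul
    (Matrix.isUnit_nonsing_inv_iff.2 hRu)
  have hBinv : B⁻¹ = R * J⁻¹ * R := by
    simp [B, Matrix.mul_inv_rev, Matrix.nonsing_inv_nonsing_inv _ hdet, mul_assoc]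
  have habs : CFC.abs B ≤ 1 := abs_inv_mul_mul_inv_le_one hR hRu (by rwa [hRR])
  -- `R * |B| * R` is the geometric mean of `Γ` and `Jᴴ * Γ⁻¹ * J`.
  refine ⟨R * CFC.abs B * R, ?_, ?_, ?_⟩
  · exact Matrix.nonneg_iff_posSemidef.1
      (hR.isSelfAdjoint.conjugate_nonneg (CFC.abs_nonneg B))
  · calc R * CFC.abs B * R ≤ R * 1 * R :=
          IsSelfAdjoint.conjugate_le_conjugate habs hR.isSelfAdjoint
      _ = Γ := by rw [mul_one, hRR]
  · calc R * CFC.abs B * R * J⁻¹ * (R * CFC.abs B * R)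
        = R * (CFC.abs B * (R * J⁻¹ * R) * CFC.abs B) * R := by simp only [mul_assoc]
      _ = -((R * R⁻¹) * J * (R⁻¹ * R)) := by
          rw [← hBinv, abs_mul_inv_mul_abs hB hBu]
          simp only [B, Matrix.mul_neg, Matrix.neg_mul, mul_assoc]
      _ = -J := by rw [hRi, hiR, one_mul, mul_one]

theorem isUnit_of_mem_symplecticGroup {l R : Type*} [Fintype l] [DecidableEq l] [CommRing R]
    {S : Matrix (l ⊕ l) (l ⊕ l) R} (hS : S ∈ Matrix.symplecticGroup l R) : IsUnit S :=
  (Matrix.isUnit_iff_isUnit_det S).2 (SymplecticGroup.symplectic_det hS)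

theorem sqrt_mem_symplecticGroup {M : Matrix (l ⊕ l) (l ⊕ l) ℝ} (hM : M.PosSemidef)
    (h : M ∈ Matrix.symplecticGroup l ℝ) : CFC.sqrt M ∈ Matrix.symplecticGroup l ℝ := by
  set J := Matrix.J l ℝ
  set S := CFC.sqrt M
  have hSS : S * S = M := CFC.sqrt_mul_sqrt_self M hM.nonneg
  have hS : S.PosSemidef := Matrix.nonneg_iff_posSemidef.1 (CFC.sqrt_nonneg M)
  have hSu : IsUnit S := isUnit_of_mul_isUnit_left (hSS.symm ▸ isUnit_of_mem_symplecticGroup h)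
  have hST : Sᵀ = S := by simpa using hS.isHermitian.eq
  have hJJ : J * J = -1 := Matrix.J_squared l ℝ
  have hJT : Jᴴ = -J := by simp [J]
  have hJTJ : Jᴴ * J = 1 := by rw [hJT, neg_mul, hJJ, neg_neg]
  -- Both sides are positive square roots of `M⁻¹`.
  have hconj : J * S * Jᴴ = S⁻¹ := by
    refine (CFC.mul_self_eq_mul_self_iff _ _ (hS.mul_mul_conjTranspose_same J).nonneg
      hS.inv.nonneg).1 ?_
    calc J * S * Jᴴ * (J * S * Jᴴ) = J * S * (Jᴴ * J) * S * Jᴴ := by simp only [mul_assoc]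
      _ = -J * (S * S)ᵀ * J := by
          rw [hJTJ, hJT, Matrix.transpose_mul, hST]
          noncomm_ring
      _ = S⁻¹ * S⁻¹ := by
          rw [hSS, ← SymplecticGroup.inv_eq_symplectic_inv M h, ← hSS, Matrix.mul_inv_rev]
  rw [SymplecticGroup.mem_iff, hST]
  calc S * J * S = S * (J * S * Jᴴ) * J := by simp only [mul_assoc, hJTJ, mul_one]
    _ = J := by
        rw [hconj, Matrix.mul_nonsing_inv _ ((Matrix.isUnit_iff_isUnit_det S).1 hSu), one_mul]

end GeometricMean

section ComplexBlocks

open scoped MatrixOrder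

variable {m : Type*}

theorem posSemidef_map_ofReal [Finite m] {P : Matrix m m ℝ} (hP : P.PosSemidef) :
    (P.map fun x : ℝ => (x : ℂ)).PosSemidef := by
  classical
  cases nonempty_fintype m
  obtain ⟨X, rfl⟩ := CStarAlgebra.nonneg_iff_eq_star_mul_self.1 hP.nonneg
  have hmap : (star X * X).map (fun x : ℝ => (x : ℂ)) =
      (X.map fun x : ℝ => (x : ℂ))ᴴ * X.map fun x : ℝ => (x : ℂ) := by
    ext i j
    simp [Matrix.mul_apply]
  rw [hmap]
  exact Matrix.posSemidef_conjTranspose_mul_self _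

theorem posSemidef_map_sub_I_smul_map_iff [Finite m] (A B : Matrix m m ℝ) :
    (A.map (fun x : ℝ => (x : ℂ)) - Complex.I • B.map (fun x : ℝ => (x : ℂ))).PosSemidef ↔
      (Matrix.fromBlocks A B (-B) A).PosSemidef := by
  cases nonempty_fintype m
  set H := A.map (fun x : ℝ => (x : ℂ)) - Complex.I • B.map (fun x : ℝ => (x : ℂ)) with hH
  have hherm : H.IsHermitian ↔ (Matrix.fromBlocks A B (-B) A).IsHermitian := by
    have hentries : H.IsHermitian ↔ Aᵀ = A ∧ Bᵀ = -B := by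
      simp only [Matrix.IsHermitian, ← Matrix.ext_iff, ← forall_and]
      simp [hH, Complex.ext_iff]
    rw [hentries, Matrix.isHermitian_fromBlocks_iff]
    simp +contextual [Matrix.IsHermitian, neg_eq_iff_eq_neg]
  have hre (x y : m → ℝ) :
      (star (fun i => (⟨x i, y i⟩ : ℂ)) ⬝ᵥ H *ᵥ fun i => (⟨x i, y i⟩ : ℂ)).re =
        Sum.elim x y ⬝ᵥ Matrix.fromBlocks A B (-B) A *ᵥ Sum.elim x y := by
    simp only [dotProduct, Matrix.mulVec, Fintype.sum_sum_type, Matrix.fromBlocks_apply₁₁,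
      Matrix.fromBlocks_apply₁₂, Matrix.fromBlocks_apply₂₁, Matrix.fromBlocks_apply₂₂,
      Sum.elim_inl, Sum.elim_inr, Complex.re_sum, Finset.mul_sum, mul_add,
      ← Finset.sum_add_distrib]
    refine Finset.sum_congr rfl fun i _ => Finset.sum_congr rfl fun j _ => ?_
    simp only [hH, Pi.star_apply, RCLike.star_def, Matrix.sub_apply, Matrix.map_apply,
      Matrix.smul_apply, Matrix.neg_apply, smul_eq_mul, Complex.mul_re, Complex.mul_im,
      Complex.conj_re, Complex.conj_im, Complex.sub_re, Complex.sub_im, Complex.ofReal_re,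
      Complex.ofReal_im, Complex.I_re, Complex.I_im]
    ring
  rw [Matrix.posSemidef_iff_dotProduct_mulVec, Matrix.posSemidef_iff_dotProduct_mulVec, hherm]
  refine and_congr_right fun hs => ⟨fun h w => ?_, fun h z => ?_⟩
  · have hw := (Complex.nonneg_iff.1 (h fun i => ⟨(w ∘ .inl) i, (w ∘ .inr) i⟩)).1
    rwa [hre, Sum.elim_comp_inl_inr w] at hw
  · refine Complex.nonneg_iff.2 ⟨?_, ((hherm.2 hs).im_star_dotProduct_mulVec_self z).symm⟩
    rw [hre (fun i => (z i).re) fun i => (z i).im]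
    exact h _

variable [Fintype m] [DecidableEq m]

theorem posDef_of_posSemidef_fromBlocks_neg {A B : Matrix m m ℝ} (hu : IsUnit B)
    (h : (Matrix.fromBlocks A B (-B) A).PosSemidef) : A.PosDef := by
  have hA : A.PosSemidef := h.submatrix Sum.inl
  refine .of_dotProduct_mulVec_pos hA.isHermitian fun v hv =>
    (hA.dotProduct_mulVec_nonneg v).lt_of_ne' fun hvA => hv ?_
  have hker := (h.dotProduct_mulVec_zero_iff (Sum.elim v 0)).1 (by
    simpa [Matrix.fromBlocks_mulVec] using hvA)
  have hBv : B *ᵥ v = 0 := by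
    ext i
    simpa [Matrix.fromBlocks_mulVec, Matrix.neg_mulVec] using congrFun hker (Sum.inr i)
  exact Matrix.mulVec_injective_of_isUnit hu (hBv.trans (Matrix.mulVec_zero B).symm)

theorem posSemidef_map_sub_I_smul_map_iff_posDef {A B : Matrix m m ℝ} (hB : Bᵀ = -B)
    (hu : IsUnit B) :
    (A.map (fun x : ℝ => (x : ℂ)) - Complex.I • B.map (fun x : ℝ => (x : ℂ))).PosSemidef ↔
      A.PosDef ∧ Bᵀ * A⁻¹ * B ≤ A := by
  rw [posSemidef_map_sub_I_smul_map_iff, Matrix.le_iff]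
  have hschur (hA : A.PosDef) :
      (Matrix.fromBlocks A B (-B) A).PosSemidef ↔ (A - Bᵀ * A⁻¹ * B).PosSemidef := by
    have := hA.isUnit.invertible
    rw [← hB]
    exact Matrix.PosDef.fromBlocks₁₁ B A hA
  exact ⟨fun h => have hA := posDef_of_posSemidef_fromBlocks_neg hu h; ⟨hA, (hschur hA).1 h⟩,
    fun ⟨hA, h⟩ => (hschur hA).2 h⟩

end ComplexBlocks

section CovarianceMatrices

open scoped MatrixOrder

variable {n : ℕ}

theorem sympForm_eq_neg_J : sympForm n = -Matrix.J (Fin n) ℝ := by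
  simp [sympForm, Matrix.J, Matrix.fromBlocks_neg]

theorem transpose_sympForm : (sympForm n)ᵀ = -sympForm n := by
  simp [sympForm_eq_neg_J]

theorem isUnit_sympForm : IsUnit (sympForm n) := by
  rw [sympForm_eq_neg_J, IsUnit.neg_iff]
  exact isUnit_of_mem_symplecticGroup (SymplecticGroup.J_mem _ _)

theorem mem_covarianceMatrices_iff {Γ : PhaseMatrix n} :
    Γ ∈ covarianceMatrices n ↔ Γ.PosDef ∧ (sympForm n)ᵀ * Γ⁻¹ * sympForm n ≤ Γ :=
  posSemidef_map_sub_I_smul_map_iff_posDef transpose_sympForm isUnit_sympForm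

theorem isUpperSet_covarianceMatrices : IsUpperSet (covarianceMatrices n) := by
  intro Γ Γ' hle hΓ
  have hsum := Matrix.PosSemidef.add hΓ (posSemidef_map_ofReal (Matrix.le_iff.1 hle))
  change Matrix.PosSemidef (_ - _)
  convert hsum using 1
  ext i j
  simp

theorem convex_covarianceMatrices : Convex ℝ (covarianceMatrices n) := by
  intro A hA B hB a b ha hb hab
  obtain rfl := eq_sub_of_add_eq hab
  have hsum := (Matrix.PosSemidef.smul hA ha).add (Matrix.PosSemidef.smul hB hb)
  change Matrix.PosSemidef (_ - _)
  convert hsum using 1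
  ext i j
  simp only [Matrix.sub_apply, Matrix.map_apply, Matrix.add_apply, Matrix.smul_apply, smul_eq_mul,
    Complex.ofReal_add, Complex.ofReal_mul, Complex.ofReal_sub, Complex.ofReal_one,
    Complex.real_smul]
  ring

theorem transpose_mul_self_mem_covarianceMatrices {S : PhaseMatrix n}
    (hS : S ∈ Matrix.symplecticGroup (Fin n) ℝ) : Sᵀ * S ∈ covarianceMatrices n := by
  have hinv := SymplecticGroup.inv_eq_symplectic_inv (Sᵀ * S)
    (mul_mem (SymplecticGroup.transpose_mem hS) hS)
  refine mem_covarianceMatrices_iff.2 ⟨.conjTranspose_mul_self S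
    (Matrix.mulVec_injective_of_isUnit (isUnit_of_mem_symplecticGroup hS)), le_of_eq ?_⟩
  have hJJ := Matrix.J_squared (Fin n) ℝ
  calc (sympForm n)ᵀ * (Sᵀ * S)⁻¹ * sympForm n
      = (Matrix.J (Fin n) ℝ * Matrix.J (Fin n) ℝ) * (Sᵀ * S) *
          (Matrix.J (Fin n) ℝ * Matrix.J (Fin n) ℝ) := by
        rw [hinv, transpose_sympForm, sympForm_eq_neg_J, Matrix.transpose_mul,
          Matrix.transpose_transpose]
        noncomm_ring
    _ = Sᵀ * S := by rw [hJJ]; simp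

/-- The symplectic matrices `S` with `SᵀS ≤ Γ`, over which the infimum `G(Γ)` is taken. -/
def feasibleSymplectics (Γ : PhaseMatrix n) : Set (PhaseMatrix n) :=
  {S | S ∈ Matrix.symplecticGroup (Fin n) ℝ ∧ Sᵀ * S ≤ Γ}

theorem feasibleSymplectics_mono : Monotone (feasibleSymplectics (n := n)) :=
  fun _ _ hle _ hS => ⟨hS.1, hS.2.trans hle⟩

theorem nonempty_feasibleSymplectics {Γ : PhaseMatrix n} (hΓ : Γ ∈ covarianceMatrices n) :
    (feasibleSymplectics Γ).Nonempty := by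
  obtain ⟨hpos, hschur⟩ := mem_covarianceMatrices_iff.1 hΓ
  obtain ⟨M, hM, hMΓ, hMJM⟩ := exists_posSemidef_le_mul_inv_mul_eq_neg
    (J := sympForm n) hpos transpose_sympForm isUnit_sympForm hschur
  have hinv : (sympForm n)⁻¹ = Matrix.J (Fin n) ℝ := by
    refine Matrix.inv_eq_right_inv ?_
    rw [sympForm_eq_neg_J, neg_mul, Matrix.J_squared, neg_neg]
  have hMT : Mᵀ = M := by simpa using hM.isHermitian.eq
  have hMsymp : M ∈ Matrix.symplecticGroup (Fin n) ℝ := by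
    rw [SymplecticGroup.mem_iff, hMT, ← hinv, hMJM, hinv, sympForm_eq_neg_J, neg_neg]
  have hsqrt : (CFC.sqrt M)ᵀ = CFC.sqrt M := by
    simpa using (Matrix.nonneg_iff_posSemidef.1 (CFC.sqrt_nonneg M)).isHermitian.eq
  refine ⟨CFC.sqrt M, sqrt_mem_symplecticGroup hM hMsymp, ?_⟩
  rwa [hsqrt, CFC.sqrt_mul_sqrt_self M hM.nonneg]

theorem isClosed_setOf_mem_feasibleSymplectics :
    IsClosed {p : PhaseMatrix n × PhaseMatrix n | p.2 ∈ feasibleSymplectics p.1} := by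
  have hsymp : IsClosed (Matrix.symplecticGroup (Fin n) ℝ : Set (PhaseMatrix n)) := by
    have heq : (Matrix.symplecticGroup (Fin n) ℝ : Set (PhaseMatrix n)) =
        {S | S * Matrix.J (Fin n) ℝ * Sᵀ = Matrix.J (Fin n) ℝ} := rfl
    rw [heq]
    exact isClosed_eq (by fun_prop) continuous_const
  exact (hsymp.preimage continuous_snd).inter <| isClosed_setOf_le.preimage
    (by fun_prop : Continuous fun p : PhaseMatrix n × PhaseMatrix n => (p.2ᵀ * p.2, p.1))

theorem exists_isCompact_eventually_feasibleSymplectics_subset (Γ : PhaseMatrix n) :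
    ∃ K : Set (PhaseMatrix n), IsCompact K ∧ ∀ᶠ Γ' in 𝓝 Γ, feasibleSymplectics Γ' ⊆ K := by
  refine ⟨_, isCompact_setOf_abs_apply_le fun _ j => √(Γ j j + 1), ?_⟩
  have hdiag : ∀ᶠ Γ' in 𝓝 Γ, ∀ j, Γ' j j < Γ j j + 1 := Filter.eventually_all.2 fun j =>
    (continuous_id.matrix_elem j j).continuousAt.eventually (gt_mem_nhds (lt_add_one (Γ j j)))
  filter_upwards [hdiag] with Γ' hΓ' S hS i j
  exact (abs_apply_le_sqrt_of_transpose_mul_self_le hS.2 i j).trans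
    (Real.sqrt_le_sqrt (hΓ' j).le)

theorem isCompact_feasibleSymplectics (Γ : PhaseMatrix n) :
    IsCompact (feasibleSymplectics Γ) := by
  obtain ⟨K, hK, hsub⟩ := exists_isCompact_eventually_feasibleSymplectics_subset Γ
  exact hK.of_isClosed_subset
    (isClosed_setOf_mem_feasibleSymplectics.preimage (Continuous.prodMk_right Γ))
    hsub.self_of_nhds

end CovarianceMatrices

section Squeezing

open scoped MatrixOrder

variable {n : ℕ}

theorem squeezingF_le_add_mul_log {A B : PhaseMatrix n} (hA : IsUnit A) {c : ℝ} (hc : 0 < c)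
    (h : Aᵀ * A ≤ c ^ 2 • (Bᵀ * B)) : squeezingF A ≤ squeezingF B + n * Real.log c := by
  have hle (i : ℕ) : (Matrix.toEuclideanLin A).singularValues i ≤
      c * (Matrix.toEuclideanLin B).singularValues i :=
    singularValues_le_mul_singularValues_of_norm_le _ _ hc.le
      (norm_toEuclideanLin_le_of_conjTranspose_mul_self_le hc.le h) i
  have hcard : (n : ℝ) * Real.log c = ∑ _i ∈ Finset.range n, Real.log c := by simp
  rw [squeezingF, squeezingF, hcard, ← Finset.sum_add_distrib]
  refine Finset.sum_le_sum fun i hi => ?_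
  have hApos : 0 < (Matrix.toEuclideanLin A).singularValues i :=
    singularValues_toEuclideanLin_pos hA <| by
      simpa using (Finset.mem_range.1 hi).trans_le (Nat.le_add_left n n)
  have hBpos := pos_of_mul_pos_right (hApos.trans_le (hle i)) hc.le
  rw [add_comm, ← Real.log_mul hc.ne' hBpos.ne']
  exact Real.log_le_log hApos (hle i)

theorem lowerSemicontinuousAt_squeezingF {S : PhaseMatrix n} (hS : IsUnit S) :
    LowerSemicontinuousAt squeezingF S := by
  intro y hy
  obtain ⟨c, hc, hcy⟩ := exists_one_lt_mul_log_lt n (sub_pos.2 hy)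
  have hpd : (Sᵀ * S).PosDef :=
    .conjTranspose_mul_self S (Matrix.mulVec_injective_of_isUnit hS)
  have hlim : Filter.Tendsto (fun A : PhaseMatrix n => Aᵀ * A) (𝓝 S) (𝓝 (Sᵀ * S)) :=
    (by fun_prop : Continuous fun A : PhaseMatrix n => Aᵀ * A).tendsto S
  filter_upwards [hlim.eventually (eventually_ge_smul hpd (one_lt_pow₀ hc two_ne_zero))] with A hA
  have hF := squeezingF_le_add_mul_log hS (zero_lt_one.trans hc)
    (hA (Matrix.isHermitian_conjTranspose_mul_self A))
  linarith

theorem eventually_forall_squeezingF_lt {S : PhaseMatrix n} (hS : IsUnit S) {y : ℝ}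
    (hy : squeezingF S < y) :
    ∀ᶠ M in 𝓝 (Sᵀ * S), ∀ T : PhaseMatrix n, IsUnit T → Tᵀ * T ≤ M → squeezingF T < y := by
  obtain ⟨c, hc, hcy⟩ := exists_one_lt_mul_log_lt n (sub_pos.2 hy)
  have hpd : (Sᵀ * S).PosDef :=
    .conjTranspose_mul_self S (Matrix.mulVec_injective_of_isUnit hS)
  filter_upwards [eventually_le_smul hpd (one_lt_pow₀ hc two_ne_zero)] with M hM T hT hTM
  have hherm : M.IsHermitian := by
    simpa using (Matrix.le_iff.1 hTM).isHermitian.add (Matrix.isHermitian_conjTranspose_mul_self T)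
  have hF := squeezingF_le_add_mul_log hT (zero_lt_one.trans hc) (hTM.trans (hM hherm))
  linarith

theorem squeezingCosts_eq_image (Γ : PhaseMatrix n) :
    squeezingCosts Γ = squeezingF '' feasibleSymplectics Γ := by
  ext c
  simp only [squeezingCosts, feasibleSymplectics, Matrix.le_iff, Set.mem_image, Set.mem_ofPred_eq,
    and_assoc, eq_comm]

theorem lowerSemicontinuousOn_squeezingF_feasibleSymplectics (Γ : PhaseMatrix n) :
    LowerSemicontinuousOn squeezingF (feasibleSymplectics Γ) := fun _ hS =>
  (lowerSemicontinuousAt_squeezingF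
    (isUnit_of_mem_symplecticGroup hS.1)).lowerSemicontinuousWithinAt _

theorem bddBelow_squeezingCosts (Γ : PhaseMatrix n) : BddBelow (squeezingCosts Γ) := by
  rw [squeezingCosts_eq_image]
  exact (lowerSemicontinuousOn_squeezingF_feasibleSymplectics Γ).bddBelow_of_isCompact
    (isCompact_feasibleSymplectics Γ)

theorem squeezingG_le {Γ S : PhaseMatrix n} (hS : S ∈ feasibleSymplectics Γ) :
    squeezingG Γ ≤ squeezingF S :=
  csInf_le (bddBelow_squeezingCosts Γ) ⟨S, hS.1, hS.2, rfl⟩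

theorem nonempty_squeezingCosts {Γ : PhaseMatrix n} (hΓ : Γ ∈ covarianceMatrices n) :
    (squeezingCosts Γ).Nonempty := by
  rw [squeezingCosts_eq_image]
  exact (nonempty_feasibleSymplectics hΓ).image _

theorem exists_squeezingF_eq_squeezingG {Γ : PhaseMatrix n} (hΓ : Γ ∈ covarianceMatrices n) :
    ∃ S ∈ feasibleSymplectics Γ, squeezingF S = squeezingG Γ := by
  obtain ⟨S, hS, hmin⟩ := (lowerSemicontinuousOn_squeezingF_feasibleSymplectics Γ).exists_isMinOn
    (nonempty_feasibleSymplectics hΓ) (isCompact_feasibleSymplectics Γ)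
  refine ⟨S, hS, le_antisymm (le_csInf (nonempty_squeezingCosts hΓ) ?_) (squeezingG_le hS)⟩
  rw [squeezingCosts_eq_image, Set.forall_mem_image]
  exact hmin

theorem lowerSemicontinuousOn_squeezingG :
    LowerSemicontinuousOn (squeezingG (n := n)) (covarianceMatrices n) := by
  intro Γ _ y hy
  obtain ⟨K, hK, hsub⟩ := exists_isCompact_eventually_feasibleSymplectics_subset Γ
  have hlt : ∀ᶠ Γ' in 𝓝 Γ, ∀ S ∈ K, S ∈ feasibleSymplectics Γ' → y < squeezingF S :=
    eventually_forall_mem_compact_lt hK isClosed_setOf_mem_feasibleSymplectics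
      (fun S hS => lowerSemicontinuousAt_squeezingF (isUnit_of_mem_symplecticGroup hS.1))
      fun S hS => hy.trans_le (squeezingG_le hS)
  filter_upwards [hsub.filter_mono nhdsWithin_le_nhds, hlt.filter_mono nhdsWithin_le_nhds,
    self_mem_nhdsWithin] with Γ' hK' hlt' hΓ'
  obtain ⟨S, hS, hSG⟩ := exists_squeezingF_eq_squeezingG hΓ'
  exact hSG ▸ hlt' S (hK' hS) hS

theorem antitoneOn_squeezingG : AntitoneOn (squeezingG (n := n)) (covarianceMatrices n) := by
  intro Γ hΓ Γ' _ hle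
  obtain ⟨S, hS, hSG⟩ := exists_squeezingF_eq_squeezingG hΓ
  exact hSG ▸ squeezingG_le (feasibleSymplectics_mono hle hS)

theorem tendsto_squeezingG_add_smul_one {Γ : PhaseMatrix n} (hΓ : Γ ∈ covarianceMatrices n) :
    Filter.Tendsto (fun ε : ℝ => squeezingG (Γ + ε • (1 : PhaseMatrix n)))
      (𝓝[>] 0) (𝓝 (squeezingG Γ)) := by
  have hle : ∀ᶠ ε : ℝ in 𝓝[>] 0, Γ ≤ Γ + ε • (1 : PhaseMatrix n) := by
    filter_upwards [self_mem_nhdsWithin] with ε hε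
    exact le_add_of_nonneg_right (Matrix.PosSemidef.one.smul (le_of_lt hε)).nonneg
  have hlim : Filter.Tendsto (fun ε : ℝ => Γ + ε • (1 : PhaseMatrix n)) (𝓝[>] 0)
      (𝓝[covarianceMatrices n] Γ) := by
    refine tendsto_nhdsWithin_iff.2
      ⟨?_, hle.mono fun ε hε => isUpperSet_covarianceMatrices hε hΓ⟩
    have hcont : Continuous fun ε : ℝ => Γ + ε • (1 : PhaseMatrix n) := by fun_prop
    simpa using (hcont.tendsto 0).mono_left nhdsWithin_le_nhds
  refine tendsto_order.2 ⟨fun y hy => ?_, fun y hy => ?_⟩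
  · exact hlim.eventually (lowerSemicontinuousOn_squeezingG Γ hΓ y hy)
  · filter_upwards [hle] with ε hε
    exact (antitoneOn_squeezingG hΓ (isUpperSet_covarianceMatrices hε hΓ) hε).trans_lt hy

theorem exists_pos_sub_smul_one_mem_covarianceMatrices {Γ : SymmPhaseMatrix n}
    (hΓ : Γ ∈ covarianceInterior n) :
    ∃ δ : ℝ, 0 < δ ∧ (Γ : PhaseMatrix n) - δ • (1 : PhaseMatrix n) ∈ covarianceMatrices n := by
  let γ (δ : ℝ) : SymmPhaseMatrix n :=
    ⟨(Γ : PhaseMatrix n) - δ • (1 : PhaseMatrix n), Γ.2.sub (Matrix.isSymm_one.smul δ)⟩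
  have hγ : Continuous γ := Continuous.subtype_mk (by fun_prop) _
  have hγ0 : γ 0 = Γ := Subtype.ext (by simp [γ])
  have hmem : ∀ᶠ δ in 𝓝[>] (0 : ℝ), (γ δ : PhaseMatrix n) ∈ covarianceMatrices n :=
    (hγ.continuousAt.eventually (hγ0.symm ▸ mem_interior_iff_mem_nhds.1 hΓ)).filter_mono
      nhdsWithin_le_nhds
  have hpos : ∀ᶠ δ in 𝓝[>] (0 : ℝ), 0 < δ := self_mem_nhdsWithin
  exact (hpos.and hmem).exists

theorem exists_mem_feasibleSymplectics_convexComb_squeezingF_lt {S N : PhaseMatrix n}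
    (hS : S ∈ Matrix.symplecticGroup (Fin n) ℝ) (hN : N ∈ covarianceMatrices n) {y : ℝ}
    (hy : squeezingF S < y) :
    ∃ t ∈ Set.Ioo (0 : ℝ) 1, ∃ T ∈ feasibleSymplectics ((1 - t) • (Sᵀ * S) + t • N),
      squeezingF T < y := by
  have hlim : Filter.Tendsto (fun t : ℝ => (1 - t) • (Sᵀ * S) + t • N) (𝓝[>] 0)
      (𝓝 (Sᵀ * S)) := by
    have hcont : Continuous fun t : ℝ => (1 - t) • (Sᵀ * S) + t • N := by fun_prop
    simpa using (hcont.tendsto 0).mono_left nhdsWithin_le_nhds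
  obtain ⟨t, hlt, ht⟩ := ((hlim.eventually (eventually_forall_squeezingF_lt
    (isUnit_of_mem_symplecticGroup hS) hy)).and (Ioo_mem_nhdsGT zero_lt_one)).exists
  obtain ⟨T, hT⟩ := nonempty_feasibleSymplectics <| convex_covarianceMatrices
    (transpose_mul_self_mem_covarianceMatrices hS) hN (sub_nonneg.2 ht.2.le) ht.1.le
    (sub_add_cancel 1 t)
  exact ⟨t, ht, T, hT, hlt T (isUnit_of_mem_symplecticGroup hT.1) hT.2⟩

theorem eventually_squeezingG_lt {Γ : PhaseMatrix n} {δ : ℝ} (hδ : 0 < δ)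
    (hΓδ : Γ - δ • (1 : PhaseMatrix n) ∈ covarianceMatrices n) {y : ℝ} (hy : squeezingG Γ < y) :
    ∀ᶠ Γ' in 𝓝 Γ, Γ'.IsSymm → squeezingG Γ' < y := by
  have hΓ : Γ ∈ covarianceMatrices n := isUpperSet_covarianceMatrices
    (sub_le_self Γ (Matrix.PosSemidef.one.smul hδ.le).nonneg) hΓδ
  obtain ⟨S, hS, hSG⟩ := exists_squeezingF_eq_squeezingG hΓ
  obtain ⟨t, ⟨ht0, ht1⟩, T, hT, hTy⟩ :=
    exists_mem_feasibleSymplectics_convexComb_squeezingF_lt hS.1 hΓδ (hSG.trans_lt hy)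
  filter_upwards [eventually_sub_le (mem_covarianceMatrices_iff.1 hΓ).1.isHermitian
    (Matrix.PosDef.one.smul (mul_pos ht0 hδ))] with Γ' hΓ' hsymm
  have hle : (1 - t) • (Sᵀ * S) + t • (Γ - δ • (1 : PhaseMatrix n)) ≤ Γ' :=
    calc (1 - t) • (Sᵀ * S) + t • (Γ - δ • (1 : PhaseMatrix n))
        ≤ (1 - t) • Γ + t • (Γ - δ • (1 : PhaseMatrix n)) := by
          have := sub_nonneg.2 ht1.le
          gcongr
          exact hS.2
      _ = Γ - (t * δ) • (1 : PhaseMatrix n) := by module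
      _ ≤ Γ' := hΓ' hsymm
  exact (squeezingG_le (feasibleSymplectics_mono hle hT)).trans_lt hTy

theorem continuousOn_squeezingG_covarianceInterior :
    ContinuousOn (fun Γ : SymmPhaseMatrix n => squeezingG (Γ : PhaseMatrix n))
      (covarianceInterior n) := by
  intro Γ hΓ
  have hmem : ∀ Γ' ∈ covarianceInterior n, (Γ' : PhaseMatrix n) ∈ covarianceMatrices n :=
    fun Γ' h => (interior_subset h : Γ' ∈ {Γ : SymmPhaseMatrix n | ↑Γ ∈ covarianceMatrices n})
  have hlim : Filter.Tendsto ((↑) : SymmPhaseMatrix n → PhaseMatrix n)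
      (𝓝[covarianceInterior n] Γ) (𝓝[covarianceMatrices n] (Γ : PhaseMatrix n)) :=
    continuous_subtype_val.continuousWithinAt.tendsto_nhdsWithin hmem
  obtain ⟨δ, hδ, hΓδ⟩ := exists_pos_sub_smul_one_mem_covarianceMatrices hΓ
  refine tendsto_order.2 ⟨fun y hy => ?_, fun y hy => ?_⟩
  · exact hlim.eventually (lowerSemicontinuousOn_squeezingG _ (hmem Γ hΓ) y hy)
  · filter_upwards [(hlim.mono_right nhdsWithin_le_nhds).eventually
      (eventually_squeezingG_lt hδ hΓδ hy)] with Γ' hΓ'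
    exact hΓ' Γ'.2

end Squeezing

theorem mainTheorem6 (n : ℕ) :
    (∀ Γ ∈ covarianceMatrices n,
      (squeezingCosts Γ).Nonempty ∧ BddBelow (squeezingCosts Γ)) ∧
    LowerSemicontinuousOn (fun Γ : PhaseMatrix n => squeezingG Γ) (covarianceMatrices n) ∧
    ContinuousOn (fun Γ : SymmPhaseMatrix n => squeezingG (Γ : PhaseMatrix n))
      (covarianceInterior n) ∧
    ∀ Γ ∈ covarianceMatrices n,
      Filter.Tendsto (fun ε : ℝ => squeezingG (Γ + ε • (1 : PhaseMatrix n)))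
        (𝓝[>] 0) (𝓝 (squeezingG Γ)) :=
  ⟨fun Γ hΓ => ⟨nonempty_squeezingCosts hΓ, bddBelow_squeezingCosts Γ⟩,
    lowerSemicontinuousOn_squeezingG, continuousOn_squeezingG_covarianceInterior,
    fun _ hΓ => tendsto_squeezingG_add_smul_one hΓ⟩
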